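/- Let $X$ be a two-sided quaternionic Banach space, i.e. a complete normed space with commuting left and right multiplications by quaternions that agree on $\mathbb{R}$ and satisfy $\|qv\|=\|vq\|=|q|\,\|v\|$ for $q\in\mathbb{H}$, $v\in X$. Let $\mathcal{B}(X)$ be the algebra of bounded right $\mathbb{H}$-linear operators on $X$, with the operator norm and identity $\mathcal{I}$; for $A\in\mathcal{B}(X)$ and $q\in\mathbb{H}$ let $Aq\in\mathcal{B}(X)$ denote the operator $v\mapsto A(qv)$. For $T\in\mathcal{B}(X)$ and $s\in\mathbb{H}$ put $$Q_s(T)=T^2-2\,\mathrm{Re}(s)\,T+|s|^2\mathcal{I},\qquad \rho_S(T)=\{s\in\mathbb{H}: Q_s(T)\text{ is invertible in }\mathcal{B}(X)\},\qquad \sigma_S(T)=\mathbb{H}\setminus\rho_S(T),$$ and, for $s\in\rho_S(T)$, $$S_L^{-2}(s,T)=Q_s(T)^{-2}\sum_{m=0}^{2}\binom{2}{m}(-T)^m\,\overline{s}^{\,2-m}.$$ Let $\mathbb{B}=\{q\in\mathbb{H}:|q|<1\}$. **Theorem.** Let $T\in\mathcal{B}(X)$. Suppose that $\sigma_S(T)\cap\partial\mathbb{B}\subseteq\{1\}$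 and that there exist constants $C>0$ and $0<\alpha\le 1$ such that $$\|S_L^{-2}(s,T)\|\le\frac{C}{|s-1|^{1+\alpha}}\qquad\text{for all } s\in\rho_S(T)\text{ with }|s|>1.$$ Then $T$ is power-bounded, i.e. $\sup_{n\ge 1}\|T^n\|<\infty$. -/

import Mathlib

open scoped Quaternion

noncomputable section

namespace QuaternionicOperator

/-! Throughout, `X` is a two-sided vector space over the quaternions: `ℍ[ℝ]` acts on the left, the
opposite ring `ℍ[ℝ]ᵐᵒᵖ` acts on the right (`MulOpposite.op q • v` is `v q`), the two actions commute
and both restrict to the same action of the real numbers. Each of the norm identities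
`‖q v‖ = |q| ‖v‖` and `‖v q‖ = |q| ‖v‖` is expressed by `NormSMulClass`. Thus
`X →L[ℍ[ℝ]ᵐᵒᵖ] X` is the ring of bounded right linear operators on `X`. -/

variable {X : Type*} [NormedAddCommGroup X] [NormedSpace ℝ X]
  [Module ℍ[ℝ] X] [Module ℍ[ℝ]ᵐᵒᵖ X] [SMulCommClass ℍ[ℝ]ᵐᵒᵖ ℍ[ℝ] X]
  [IsScalarTower ℝ ℍ[ℝ] X] [IsScalarTower ℝ ℍ[ℝ]ᵐᵒᵖ X]
  [NormSMulClass ℍ[ℝ] X] [NormSMulClass ℍ[ℝ]ᵐᵒᵖ X]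

/-- The operator norm of a bounded right linear operator. It does not depend on the scalars, so it
may be computed after restricting them to the real numbers. -/
def opNorm (T : X →L[ℍ[ℝ]ᵐᵒᵖ] X) : ℝ :=
  ‖T.restrictScalars ℝ‖

/-- The operator `s I`, that is, left multiplication `v ↦ s v`. -/
def scalarOp (X : Type*) [NormedAddCommGroup X] [Module ℍ[ℝ] X] [Module ℍ[ℝ]ᵐᵒᵖ X]
    [SMulCommClass ℍ[ℝ]ᵐᵒᵖ ℍ[ℝ] X] [NormSMulClass ℍ[ℝ] X] (s : ℍ[ℝ]) : X →L[ℍ[ℝ]ᵐᵒᵖ] X :=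
  s • (1 : X →L[ℍ[ℝ]ᵐᵒᵖ] X)

/-- `Q_s(T) = T² - 2 Re(s) T + |s|² I`. -/
def Q (s : ℍ[ℝ]) (T : X →L[ℍ[ℝ]ᵐᵒᵖ] X) : X →L[ℍ[ℝ]ᵐᵒᵖ] X :=
  T ^ 2 - (2 * s.re) • T + (‖s‖ ^ 2) • (1 : X →L[ℍ[ℝ]ᵐᵒᵖ] X)

/-- The `S`-resolvent set: those `s` for which `Q_s(T)` is invertible among the bounded right linear
operators. -/
def sResolventSet (T : X →L[ℍ[ℝ]ᵐᵒᵖ] X) : Set ℍ[ℝ] :=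
  {s | IsUnit (Q s T)}

/-- The `S`-spectrum. -/
def sSpectrum (T : X →L[ℍ[ℝ]ᵐᵒᵖ] X) : Set ℍ[ℝ] :=
  (sResolventSet T)ᶜ

/-- The `n`-th power of the left `S`-resolvent operator,
`S_L^{-n}(s,T) = Q_s(T)^{-n} ∑_{m=0}^{n} (n choose m) (-T)^m s̄^{n-m}`, where `A q` denotes the operator
`v ↦ A (q v)`. It is meaningful for `s` in the `S`-resolvent set, where `Ring.inverse` is the
inverse. -/
def sLeftResolventPow (n : ℕ) (s : ℍ[ℝ]) (T : X →L[ℍ[ℝ]ᵐᵒᵖ] X) : X →L[ℍ[ℝ]ᵐᵒᵖ] X :=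
  Ring.inverse (Q s T) ^ n *
    ∑ m ∈ Finset.range (n + 1), n.choose m • ((-T) ^ m * scalarOp X (star s ^ (n - m)))

/-- `T` is power-bounded: the norms `‖Tⁿ‖`, `n ≥ 1`, are bounded. -/
def IsPowerBounded (T : X →L[ℍ[ℝ]ᵐᵒᵖ] X) : Prop :=
  BddAbove ((fun n : ℕ => opNorm (T ^ n)) '' Set.Ici 1)

end QuaternionicOperator

end

/-!
Put `a = T` as a real-linear map. If `‖aⁿ‖ ≤ c qⁿ` for all `n` and `q < |s|`, then `s` lies in the
`S`-resolvent set and the left resolvent has the expansion `S_L^{-2}(s,T) v = ∑ₖ (k + 1) Tᵏ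
s^{-k-2} v` (`mem_sResolventSet_of_geometric`, `sLeftResolventPow_two_apply`). Applying this to
`s^{n+2} v` and averaging over the circle `|s| = r` in the slice `ℂ ⊆ ℍ` leaves only the term `k =
n`, which is `(n + 1) Tⁿ v` (`circleAverage_resolventSqSeries`). On that circle `|s - 1| ≤ r + 1`,
so the resolvent estimate gives `‖S_L^{-2}(s,T)‖ ≤ C (r + 1) / |s - 1|²`, and the mean of `1 / |s
- 1|²` is `1 / (r² - 1)` by the Poisson formula. Hence `(n + 1) ‖Tⁿ‖ ≤ C r^{n+2} / (r - 1)`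
(`succ_mul_opNorm_pow_le`), and the choice `r = 1 + 1 / (n + 1)` bounds `‖Tⁿ‖` by a constant.

The expansion is available a priori only for radii above the spectral radius. This restriction is
removed by `forall_succ_mul_norm_pow_le`: if the infimum `r₀` of the admissible radii were greater
than `1`, the estimate would persist at `r₀` and its factor `n + 1` would force `‖aᵐ‖ < r₀ᵐ` for
some `m`, which makes radii slightly smaller than `r₀` admissible as well.

The resolvent series is handled pointwise, since left multiplication by `s` does not commute with
`T`; invertibility of `Q_s(T)` is instead read off from `Q_s(T) = (R_s - T)(R_{s̄} - T)`, where
the right multiplications `R_s` do commute with `T`.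
-/

namespace QuaternionicOperator

/-! ### Growth of powers of a bounded operator -/

section Growth

/-- A single bound `‖a ^ N‖ ≤ q ^ N` controls all powers, by division with remainder by `N`. -/
theorem exists_norm_pow_le_geometric {X : Type*} [NormedAddCommGroup X] [NormedSpace ℝ X]
    {a : X →L[ℝ] X} {N : ℕ} {q : ℝ} (hN : 0 < N)
    (hq : 0 < q) (h : ‖a ^ N‖ ≤ q ^ N) : ∃ c : ℝ, ∀ n, ‖a ^ n‖ ≤ c * q ^ n := by
  refine ⟨∑ j ∈ Finset.range N, ‖a ^ j‖ / q ^ j, fun n => ?_⟩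
  set c := ∑ j ∈ Finset.range N, ‖a ^ j‖ / q ^ j
  induction n using Nat.strong_induction_on with
  | _ n ih =>
    rcases lt_or_ge n N with hn | hn
    · rw [← div_le_iff₀ (by positivity)]
      exact Finset.single_le_sum (f := fun j => ‖a ^ j‖ / q ^ j) (fun j _ => by positivity)
        (Finset.mem_range.2 hn)
    · have h1 := ih (n - N) (by omega)
      have h2 : n = (n - N) + N := by omega
      calc ‖a ^ n‖ = ‖a ^ (n - N) * a ^ N‖ := by rw [← pow_add, ← h2]
        _ ≤ ‖a ^ (n - N)‖ * ‖a ^ N‖ := norm_mul_le _ _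
        _ ≤ (c * q ^ (n - N)) * q ^ N := mul_le_mul h1 h (norm_nonneg _) ((norm_nonneg _).trans h1)
        _ = c * q ^ n := by rw [mul_assoc, ← pow_add, ← h2]

theorem exists_lt_and_lt_pow {x r b : ℝ} {N : ℕ} (h : x < r ^ N) (hb : b < r) :
    ∃ q, b < q ∧ q < r ∧ x < q ^ N := by
  have h1 : ∀ᶠ q in nhdsWithin r (Set.Iio r), x < q ^ N :=
    ((continuous_pow N).tendsto r).eventually_const_lt h |>.filter_mono nhdsWithin_le_nhds
  have h2 : ∀ᶠ q in nhdsWithin r (Set.Iio r), b < q :=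
    (eventually_gt_nhds hb).filter_mono nhdsWithin_le_nhds
  obtain ⟨q, hq1, hq2, hq3⟩ := (h1.and (h2.and self_mem_nhdsWithin)).exists
  exact ⟨q, hq2, hq3, hq1⟩

/-- A growth estimate that holds at every radius `r > 1` above a geometric growth rate `q` of the
powers of `a` holds at every radius `r > 1`, because the factor `n + 1` on its left lowers the
growth rate. -/
theorem forall_succ_mul_norm_pow_le {X : Type*} [NormedAddCommGroup X] [NormedSpace ℝ X]
    {a : X →L[ℝ] X} {C : ℝ}
    (h : ∀ c q r : ℝ, 0 < q → (∀ n, ‖a ^ n‖ ≤ c * q ^ n) → q < r → 1 < r →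
      ∀ n : ℕ, ((n : ℝ) + 1) * ‖a ^ n‖ ≤ C * r ^ (n + 2) / (r - 1))
    {r : ℝ} (hr : 1 < r) (n : ℕ) : ((n : ℝ) + 1) * ‖a ^ n‖ ≤ C * r ^ (n + 2) / (r - 1) := by
  let S : Set ℝ := {r | 1 < r ∧ ∃ N, 0 < N ∧ ‖a ^ N‖ < r ^ N}
  have hS : ∀ r ∈ S, ∀ n : ℕ, ((n : ℝ) + 1) * ‖a ^ n‖ ≤ C * r ^ (n + 2) / (r - 1) := by
    rintro r ⟨hr, N, hN, hlt⟩
    obtain ⟨q, hq, hqr, hqN⟩ := exists_lt_and_lt_pow hlt (zero_lt_one.trans hr)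
    obtain ⟨c, hc⟩ := exists_norm_pow_le_geometric hN hq hqN.le
    exact h c q r hq hc hqr hr
  have hup : ∀ r ∈ S, ∀ r', r < r' → r' ∈ S := by
    rintro r ⟨hr, N, hN, hlt⟩ r' hr'
    exact ⟨hr.trans hr', N, hN, hlt.trans_le (pow_le_pow_left₀ (by linarith) hr'.le N)⟩
  -- `N = 1` is a witness for every radius above `‖a‖`.
  have hne : S.Nonempty :=
    ⟨‖a‖ + 2, by linarith [norm_nonneg a], 1, one_pos, by rw [pow_one, pow_one]; linarith⟩
  have hbdd : BddBelow S := ⟨1, fun r hr => hr.1.le⟩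
  have hgt : ∀ r, sInf S < r → r ∈ S := fun r hr => by
    obtain ⟨t, ht, htr⟩ := exists_lt_of_csInf_lt hne hr
    exact hup t ht r htr
  suffices hinf : sInf S ≤ 1 from hS r (hgt r (hinf.trans_lt hr)) n
  by_contra! hlt
  set r₀ := sInf S
  have hr₀ : 0 < r₀ - 1 := by linarith
  have hlim : ∀ n : ℕ, ((n : ℝ) + 1) * ‖a ^ n‖ ≤ C * r₀ ^ (n + 2) / (r₀ - 1) := fun n => by
    have ht : Filter.Tendsto (fun r : ℝ => C * r ^ (n + 2) / (r - 1)) (nhdsWithin r₀ (Set.Ioi r₀))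
        (nhds (C * r₀ ^ (n + 2) / (r₀ - 1))) := by
      refine Filter.Tendsto.mono_left ?_ nhdsWithin_le_nhds
      exact ContinuousAt.div (by fun_prop) (by fun_prop) hr₀.ne'
    exact ge_of_tendsto ht (by filter_upwards [self_mem_nhdsWithin] with r hr using hS r (hgt r hr) n)
  -- The factor `n + 1` eventually exceeds the constant `C r₀² / (r₀ - 1)`.
  obtain ⟨m, hm⟩ := exists_nat_gt (C * r₀ ^ 2 / (r₀ - 1))
  have hpow : ‖a ^ (m + 1)‖ < r₀ ^ (m + 1) := by
    have h1 := hlim (m + 1)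
    have h2 : C * r₀ ^ (m + 1 + 2) / (r₀ - 1) = C * r₀ ^ 2 / (r₀ - 1) * r₀ ^ (m + 1) := by ring
    have h3 : 0 < r₀ ^ (m + 1) := by positivity
    rw [h2] at h1
    have h4 : ((m + 1 : ℕ) : ℝ) + 1 > m := by push_cast; linarith
    have h5 : 0 < ((m + 1 : ℕ) : ℝ) + 1 := by positivity
    refine lt_of_mul_lt_mul_left (h1.trans_lt ?_) h5.le
    exact mul_lt_mul_of_pos_right (hm.trans h4) h3
  obtain ⟨q, hq1, hq, hqm⟩ := exists_lt_and_lt_pow hpow hlt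
  exact absurd (csInf_le hbdd (show q ∈ S from ⟨hq1, m + 1, m.succ_pos, hqm⟩)) (not_le.2 hq)

theorem summable_succ_mul_geometric (c : ℝ) {q r : ℝ} (hq : 0 < q) (hr : q < r) :
    Summable fun k : ℕ => ((k : ℝ) + 1) * (c * (q / r) ^ k) := by
  have h1 : ‖q / r‖ < 1 := by
    rw [Real.norm_of_nonneg (div_nonneg hq.le (hq.trans hr).le)]
    exact (div_lt_one (hq.trans hr)).2 hr
  have := ((summable_pow_mul_geometric_of_norm_lt_one 1 h1).add
    (summable_geometric_of_norm_lt_one h1)).mul_left c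
  refine this.congr fun k => ?_
  ring

end Growth

/-! ### Averages over circles -/

section CircleAverage

/-- The Poisson kernel `z ↦ (r² - 1) / |z - 1|²` of the disc of radius `r` at the point `1` has
mean `1`. -/
theorem circleAverage_inv_norm_sub_one_sq {r : ℝ} (hr : 1 < r) :
    Real.circleAverage (fun z => (‖z - 1‖ ^ 2)⁻¹) 0 r = (r ^ 2 - 1)⁻¹ := by
  have hr' : r ^ 2 - 1 ≠ 0 := by nlinarith
  have h : Real.circleAverage (poissonKernel 0 1 • fun _ => (1 : ℝ)) 0 r = 1 :=
    InnerProductSpace.HarmonicContOnCl.circleAverage_poissonKernel_smul (w := 1)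
      (InnerProductSpace.harmonicContOnCl_const) (by simpa using hr)
  have h2 : Real.circleAverage (poissonKernel 0 1 • fun _ => (1 : ℝ)) 0 r
      = Real.circleAverage (fun z => (r ^ 2 - 1) • (‖z - 1‖ ^ 2)⁻¹) 0 r := by
    refine Real.circleAverage_congr_sphere fun z hz => ?_
    have hz' : ‖z‖ = r := by
      rw [mem_sphere_zero_iff_norm.1 hz, abs_of_pos (by linarith)]
    simp [poissonKernel_def, hz', div_eq_mul_inv]
  rw [h2, Real.circleAverage_fun_smul, smul_eq_mul] at h
  exact eq_inv_of_mul_eq_one_right h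

theorem circleAverage_zpow {r : ℝ} (hr : 0 < r) (m : ℤ) :
    Real.circleAverage (fun z : ℂ => z ^ m) 0 r = if m = 0 then 1 else 0 := by
  split_ifs with hm
  · subst hm
    simp [Real.circleAverage_const]
  · have h : Set.EqOn (fun z : ℂ => (z - 0)⁻¹ • z ^ m) (fun z => (z - 0) ^ (m - 1))
        (Metric.sphere 0 r) := by
      intro z hz
      have hz0 : z ≠ 0 := by
        rintro rfl
        exact hr.ne (by simpa using hz)
      simp [zpow_sub_one₀ hz0, mul_comm]
    rw [Real.circleAverage_eq_circleIntegral hr.ne', circleIntegral.integral_congr hr.le h,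
      circleIntegral.integral_sub_zpow_of_ne (by omega), smul_zero]

theorem circleIntegrable_zpow {r : ℝ} (hr : 0 < r) (m : ℤ) :
    CircleIntegrable (fun z : ℂ => z ^ m) 0 r := by
  refine ContinuousOn.circleIntegrable hr.le fun z hz => ?_
  refine (continuousAt_zpow₀ z m (Or.inl ?_)).continuousWithinAt
  rintro rfl
  exact hr.ne (by simpa using hz)

theorem norm_circleAverage_le {E : Type*} [NormedAddCommGroup E] [NormedSpace ℝ E]
    {f : ℂ → E} {g : ℂ → ℝ} {r : ℝ} (hr : 0 ≤ r) (hg : CircleIntegrable g 0 r)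
    (h : ∀ z : ℂ, ‖z‖ = r → ‖f z‖ ≤ g z) :
    ‖Real.circleAverage f 0 r‖ ≤ Real.circleAverage g 0 r := by
  have hp := Real.pi_pos
  rw [Real.circleAverage, Real.circleAverage, norm_smul, smul_eq_mul,
    Real.norm_of_nonneg (by positivity)]
  gcongr
  refine intervalIntegral.norm_integral_le_of_norm_le (by positivity)
    (Filter.Eventually.of_forall fun θ _ => h _ ?_) hg
  simp [hr]

end CircleAverage

/-! ### Left multiplication by quaternions -/

section LeftMul

variable {X : Type*} [NormedAddCommGroup X] [NormedSpace ℝ X] [Module ℍ[ℝ] X]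
  [IsScalarTower ℝ ℍ[ℝ] X]

theorem norm_coeComplex (z : ℂ) : ‖(z : ℍ[ℝ])‖ = ‖z‖ := by
  have h := Quaternion.normSq_eq_norm_mul_self (z : ℍ[ℝ])
  rw [Quaternion.normSq_def'] at h
  have h2 := Complex.sq_norm z
  rw [Complex.normSq_apply] at h2
  simp at h
  nlinarith [norm_nonneg z, norm_nonneg (z : ℍ[ℝ])]

theorem star_smul_add_smul (s : ℍ[ℝ]) (v : X) : star s • v + s • v = (2 * s.re) • v := by
  rw [← add_smul, add_comm, Quaternion.self_add_star, ← algebraMap_smul ℍ[ℝ] (2 * s.re) v,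
    Quaternion.algebraMap_def, Quaternion.coe_mul]
  rfl

theorem smul_star_smul (s : ℍ[ℝ]) (v : X) : s • star s • v = (‖s‖ ^ 2) • v := by
  rw [smul_smul, Quaternion.self_mul_star, Quaternion.normSq_eq_norm_mul_self, ← sq,
    ← algebraMap_smul ℍ[ℝ] (‖s‖ ^ 2) v]
  rfl

theorem quaternion_smul_real_smul (s : ℍ[ℝ]) (r : ℝ) (v : X) : s • r • v = r • s • v := by
  rw [← algebraMap_smul ℍ[ℝ] r v, ← algebraMap_smul ℍ[ℝ] r (s • v), smul_smul, smul_smul,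
    Algebra.commutes]

/-- The real-linear map `z ↦ z v`, where complex numbers act from the left through the slice `ℂ ⊆
ℍ` spanned by `1` and the unit `i`. -/
noncomputable def complexSMul (v : X) : ℂ →L[ℝ] X :=
  LinearMap.toContinuousLinearMap
    (((LinearMap.toSpanSingleton ℍ[ℝ] X v).restrictScalars ℝ) ∘ₗ Quaternion.ofComplex.toLinearMap)

theorem complexSMul_apply (v : X) (z : ℂ) : complexSMul v z = (z : ℍ[ℝ]) • v := rfl

end LeftMul

/-! ### Right linear operators and right multiplication -/

section RightLinear

variable {X : Type*} [NormedAddCommGroup X] [NormedSpace ℝ X] [Module ℍ[ℝ]ᵐᵒᵖ X]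
  [IsScalarTower ℝ ℍ[ℝ]ᵐᵒᵖ X]

theorem map_real_smul (B : X →L[ℍ[ℝ]ᵐᵒᵖ] X) (r : ℝ) (v : X) : B (r • v) = r • B v :=
  (B.restrictScalars ℝ).map_smul r v

theorem norm_apply_le_opNorm (B : X →L[ℍ[ℝ]ᵐᵒᵖ] X) (v : X) : ‖B v‖ ≤ opNorm B * ‖v‖ :=
  (B.restrictScalars ℝ).le_opNorm v

theorem restrictScalars_pow (T : X →L[ℍ[ℝ]ᵐᵒᵖ] X) (n : ℕ) :
    (T ^ n).restrictScalars ℝ = T.restrictScalars ℝ ^ n := by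
  induction n with
  | zero => rfl
  | succ n ih => rw [pow_succ, pow_succ, ← ih]; rfl

theorem Q_apply (s : ℍ[ℝ]) (T : X →L[ℍ[ℝ]ᵐᵒᵖ] X) (v : X) :
    Q s T v = T (T v) - (2 * s.re) • T v + (‖s‖ ^ 2) • v := rfl

theorem norm_pow_apply_le {T : X →L[ℍ[ℝ]ᵐᵒᵖ] X} {c q : ℝ}
    (hT : ∀ n, ‖T.restrictScalars ℝ ^ n‖ ≤ c * q ^ n) (n : ℕ) (v : X) :
    ‖(T ^ n) v‖ ≤ c * q ^ n * ‖v‖ := by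
  refine (norm_apply_le_opNorm _ v).trans ?_
  rw [opNorm, restrictScalars_pow]
  gcongr
  exact hT n

/-- The real-linear inverse of a right linear operator is right linear. -/
theorem isUnit_of_isUnit_restrictScalars {B : X →L[ℍ[ℝ]ᵐᵒᵖ] X}
    (h : IsUnit (B.restrictScalars ℝ)) : IsUnit B := by
  obtain ⟨u, hu⟩ := h
  have h1 : ∀ v, B (u.inv v) = v := fun v => by
    have := congrArg (fun f : X →L[ℝ] X => f v) u.val_inv
    rw [hu] at this
    exact this
  have h2 : ∀ v, u.inv (B v) = v := fun v => by
    have := congrArg (fun f : X →L[ℝ] X => f v) u.inv_val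
    rw [hu] at this
    exact this
  let B' : X →L[ℍ[ℝ]ᵐᵒᵖ] X :=
    { toFun := u.inv
      map_add' := map_add _
      map_smul' := fun q v => by
        rw [RingHom.id_apply, ← h2 (q • u.inv v), B.map_smul, h1]
      cont := u.inv.continuous }
  exact ⟨⟨B, B', ContinuousLinearMap.ext h1, ContinuousLinearMap.ext h2⟩, rfl⟩

variable [NormSMulClass ℍ[ℝ]ᵐᵒᵖ X]

/-- Right multiplication `v ↦ v q` as a bounded real-linear map. It is not right `ℍ`-linear unless
`q` is real, but it commutes with every right linear operator. -/
noncomputable def rightMul (X : Type*) [NormedAddCommGroup X] [NormedSpace ℝ X]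
    [Module ℍ[ℝ]ᵐᵒᵖ X] [IsScalarTower ℝ ℍ[ℝ]ᵐᵒᵖ X] [NormSMulClass ℍ[ℝ]ᵐᵒᵖ X] (q : ℍ[ℝ]) :
    X →L[ℝ] X :=
  LinearMap.mkContinuous
    { toFun := fun v => MulOpposite.op q • v
      map_add' := smul_add _
      map_smul' := fun r v => by
        rw [RingHom.id_apply, ← algebraMap_smul ℍ[ℝ]ᵐᵒᵖ r v,
          ← algebraMap_smul ℍ[ℝ]ᵐᵒᵖ r (MulOpposite.op q • v), smul_smul, smul_smul,
          Algebra.commutes] }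
    ‖q‖ fun v => (norm_smul _ _).le

theorem rightMul_apply (q : ℍ[ℝ]) (v : X) : rightMul X q v = MulOpposite.op q • v := rfl

theorem norm_rightMul_le (q : ℍ[ℝ]) : ‖rightMul X q‖ ≤ ‖q‖ :=
  LinearMap.mkContinuous_norm_le _ (norm_nonneg _) _

/-- `R_s - T = R_s (1 - R_s⁻¹ T)`, and the Neumann series of `R_s⁻¹ T` converges because `R_s⁻¹`
and `T` commute. -/
theorem isUnit_rightMul_sub [CompleteSpace X] (T : X →L[ℍ[ℝ]ᵐᵒᵖ] X) {c q : ℝ} (hq : 0 < q)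
    (hT : ∀ n, ‖T.restrictScalars ℝ ^ n‖ ≤ c * q ^ n) {s : ℍ[ℝ]} (hs : q < ‖s‖) :
    IsUnit (rightMul X s - T.restrictScalars ℝ) := by
  have hs0 : s ≠ 0 := norm_pos_iff.1 (hq.trans hs)
  set a := T.restrictScalars ℝ
  have hcomm : Commute (rightMul X s⁻¹) a := by
    ext v
    exact (T.map_smul _ _).symm
  set x := rightMul X s⁻¹ * a with hx
  have hsum : Summable fun n => x ^ n := by
    have hg : Summable fun n : ℕ => c * (q / ‖s‖) ^ n :=
      (summable_geometric_of_lt_one (by positivity) ((div_lt_one (hq.trans hs)).2 hs)).mul_left c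
    refine hg.of_norm_bounded fun n => ?_
    rw [hx, hcomm.mul_pow]
    calc ‖rightMul X s⁻¹ ^ n * a ^ n‖ ≤ ‖rightMul X s⁻¹ ^ n‖ * ‖a ^ n‖ := norm_mul_le _ _
      _ ≤ (‖s‖⁻¹) ^ n * (c * q ^ n) := by
        refine mul_le_mul ?_ (hT n) (norm_nonneg _) (by positivity)
        rcases Nat.eq_zero_or_pos n with rfl | hn
        · -- `norm_pow_le'` excludes `n = 0`, and `‖1‖` may be `0` when `X` is trivial.
          rw [pow_zero, pow_zero]
          exact ContinuousLinearMap.norm_id_le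
        · refine (norm_pow_le' _ hn).trans (pow_le_pow_left₀ (norm_nonneg _) ?_ n)
          simpa using norm_rightMul_le (X := X) s⁻¹
      _ = c * (q / ‖s‖) ^ n := by
        rw [div_eq_mul_inv, mul_pow]; ring
  have h1 : IsUnit (1 - x) :=
    ⟨⟨1 - x, _, hsum.one_sub_mul_tsum_pow, hsum.tsum_pow_mul_one_sub⟩, rfl⟩
  have h2 : rightMul X s * rightMul X s⁻¹ = 1 := by
    ext v
    simp [rightMul_apply, smul_smul, hs0]
  have h3 : rightMul X s⁻¹ * rightMul X s = 1 := by
    ext v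
    simp [rightMul_apply, smul_smul, hs0]
  have h4 : rightMul X s - a = rightMul X s * (1 - x) := by
    rw [mul_sub, mul_one, hx, ← mul_assoc, h2, one_mul]
  rw [h4]
  exact IsUnit.mul ⟨⟨_, _, h2, h3⟩, rfl⟩ h1

/-- Quaternions of modulus above a geometric growth rate of the powers of `T` belong to the
`S`-resolvent set, by the factorization `Q_s(T) = (R_s - T)(R_{s̄} - T)`. -/
theorem mem_sResolventSet_of_geometric [CompleteSpace X] (T : X →L[ℍ[ℝ]ᵐᵒᵖ] X) {c q : ℝ}
    (hq : 0 < q) (hT : ∀ n, ‖T.restrictScalars ℝ ^ n‖ ≤ c * q ^ n) {s : ℍ[ℝ]} (hs : q < ‖s‖) :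
    s ∈ sResolventSet T := by
  refine isUnit_of_isUnit_restrictScalars ?_
  have h : (Q s T).restrictScalars ℝ =
      (rightMul X s - T.restrictScalars ℝ) * (rightMul X (star s) - T.restrictScalars ℝ) := by
    ext v
    have h1 : MulOpposite.op s • MulOpposite.op (star s) • v = (‖s‖ ^ 2) • v := by
      rw [smul_smul, ← MulOpposite.op_mul, Quaternion.star_mul_self,
        Quaternion.normSq_eq_norm_mul_self, ← sq, ← algebraMap_smul ℍ[ℝ]ᵐᵒᵖ (‖s‖ ^ 2) v]
      rfl
    have h2 : MulOpposite.op s • T v + MulOpposite.op (star s) • T v = (2 * s.re) • T v := by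
      rw [← add_smul, ← MulOpposite.op_add, Quaternion.self_add_star,
        ← algebraMap_smul ℍ[ℝ]ᵐᵒᵖ (2 * s.re) (T v), MulOpposite.algebraMap_apply,
        Quaternion.algebraMap_def, Quaternion.coe_mul]
      rfl
    change T (T v) - (2 * s.re) • T v + (‖s‖ ^ 2) • v =
      MulOpposite.op s • (MulOpposite.op (star s) • v - T v) - T (MulOpposite.op (star s) • v - T v)
    rw [smul_sub, map_sub, T.map_smul, h1, ← h2]
    abel
  rw [h]
  exact (isUnit_rightMul_sub T hq hT hs).mul (isUnit_rightMul_sub T hq hT (by rwa [norm_star]))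

end RightLinear

/-! ### The series of the left resolvent and of its square -/

section Series

variable {X : Type*} [NormedAddCommGroup X] [NormedSpace ℝ X]
  [Module ℍ[ℝ] X] [Module ℍ[ℝ]ᵐᵒᵖ X]

/-- The series `∑ₖ Tᵏ s^{-k-1} v`, the value at `v` of the left `S`-resolvent operator
`S_L^{-1}(s,T)` when it converges absolutely. -/
noncomputable def resolventSeries (T : X →L[ℍ[ℝ]ᵐᵒᵖ] X) (s : ℍ[ℝ]) (v : X) : X :=
  ∑' k : ℕ, (T ^ k) (s⁻¹ ^ (k + 1) • v)

/-- The series `∑ₖ (k + 1) Tᵏ s^{-k-2} v`, the value at `v` of `S_L^{-2}(s,T)` when it converges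
absolutely. -/
noncomputable def resolventSqSeries (T : X →L[ℍ[ℝ]ᵐᵒᵖ] X) (s : ℍ[ℝ]) (v : X) : X :=
  ∑' k : ℕ, ((k : ℝ) + 1) • (T ^ k) (s⁻¹ ^ (k + 2) • v)

section ResolventEquations

variable [IsScalarTower ℝ ℍ[ℝ]ᵐᵒᵖ X] [NormSMulClass ℍ[ℝ] X] {T : X →L[ℍ[ℝ]ᵐᵒᵖ] X} {c q : ℝ}
  (hq : 0 < q) (hT : ∀ n, ‖T.restrictScalars ℝ ^ n‖ ≤ c * q ^ n) {s : ℍ[ℝ]} (hs : q < ‖s‖)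

include hq hT hs

theorem summable_succ_mul_norm_pow_apply (j : ℕ) (v : X) :
    Summable fun k : ℕ => ((k : ℝ) + 1) * ‖(T ^ k) (s⁻¹ ^ (k + j) • v)‖ := by
  refine (summable_succ_mul_geometric (c * (‖s‖⁻¹ ^ j * ‖v‖)) hq hs).of_norm_bounded fun k => ?_
  rw [Real.norm_of_nonneg (by positivity)]
  gcongr
  refine (norm_pow_apply_le hT k _).trans_eq ?_
  rw [norm_smul, norm_pow, norm_inv, pow_add, div_pow, inv_pow, inv_pow]
  ring

variable [CompleteSpace X]

theorem summable_succ_smul_pow_apply (j : ℕ) (v : X) :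
    Summable fun k : ℕ => ((k : ℝ) + 1) • (T ^ k) (s⁻¹ ^ (k + j) • v) := by
  refine (summable_succ_mul_norm_pow_apply hq hT hs j v).of_norm_bounded fun k => ?_
  rw [norm_smul, Real.norm_of_nonneg (by positivity)]

theorem summable_pow_apply (j : ℕ) (v : X) :
    Summable fun k : ℕ => (T ^ k) (s⁻¹ ^ (k + j) • v) := by
  refine (summable_succ_mul_norm_pow_apply hq hT hs j v).of_norm_bounded fun k => ?_
  exact le_mul_of_one_le_left (norm_nonneg _) (by linarith [k.cast_nonneg (α := ℝ)])

theorem resolventSeries_add (v w : X) :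
    resolventSeries T s (v + w) = resolventSeries T s v + resolventSeries T s w := by
  rw [resolventSeries, resolventSeries, resolventSeries,
    ← (summable_pow_apply hq hT hs 1 v).tsum_add (summable_pow_apply hq hT hs 1 w)]
  simp only [smul_add, map_add]

theorem resolventSqSeries_add (v w : X) :
    resolventSqSeries T s (v + w) = resolventSqSeries T s v + resolventSqSeries T s w := by
  rw [resolventSqSeries, resolventSqSeries, resolventSqSeries,
    ← (summable_succ_smul_pow_apply hq hT hs 2 v).tsum_add
      (summable_succ_smul_pow_apply hq hT hs 2 w)]
  simp only [smul_add, map_add]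

/-- The left resolvent equation `S_L^{-1}(s,T) s - T S_L^{-1}(s,T) = I`. -/
theorem resolventSeries_smul (v : X) :
    resolventSeries T s (s • v) = T (resolventSeries T s v) + v := by
  have hs0 : s ≠ 0 := norm_pos_iff.1 (hq.trans hs)
  have h := summable_pow_apply hq hT hs 1 v
  have h0 := summable_pow_apply hq hT hs 0 v
  have e : ∀ k : ℕ, s⁻¹ ^ (k + 1) • s • v = s⁻¹ ^ (k + 0) • v := fun k => by
    rw [smul_smul, pow_succ, mul_assoc, inv_mul_cancel₀ hs0, mul_one, add_zero]
  rw [resolventSeries, resolventSeries, T.map_tsum h]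
  simp_rw [e]
  rw [h0.tsum_eq_zero_add, add_comm]
  simp [pow_succ']

/-- The equation `S_L^{-2}(s,T) s - T S_L^{-2}(s,T) = S_L^{-1}(s,T)`. -/
theorem resolventSqSeries_smul (v : X) :
    resolventSqSeries T s (s • v) = T (resolventSqSeries T s v) + resolventSeries T s v := by
  have hs0 : s ≠ 0 := norm_pos_iff.1 (hq.trans hs)
  have h := summable_succ_smul_pow_apply hq hT hs 1 v
  have h' := summable_pow_apply hq hT hs 1 v
  have h2 := summable_succ_smul_pow_apply hq hT hs 2 v
  have e : ∀ k : ℕ, s⁻¹ ^ (k + 2) • s • v = s⁻¹ ^ (k + 1) • v := fun k => by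
    rw [smul_smul, pow_succ _ (k + 1), mul_assoc, inv_mul_cancel₀ hs0, mul_one]
  have h3 : Summable fun k : ℕ => (k : ℝ) • (T ^ k) (s⁻¹ ^ (k + 1) • v) :=
    (h.sub h').congr fun k => by rw [add_smul, one_smul, add_sub_cancel_right]
  have h4 : ∑' k : ℕ, (k : ℝ) • (T ^ k) (s⁻¹ ^ (k + 1) • v) = T (resolventSqSeries T s v) := by
    rw [resolventSqSeries, T.map_tsum h2, h3.tsum_eq_zero_add, Nat.cast_zero, zero_smul, zero_add]
    refine tsum_congr fun k => ?_
    rw [pow_succ', Nat.cast_succ]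
    exact ((T.restrictScalars ℝ).map_smul _ _).symm
  rw [← h4, resolventSeries, ← h3.tsum_add h', resolventSqSeries]
  refine tsum_congr fun k => ?_
  rw [e, add_smul, one_smul]

end ResolventEquations

variable [IsScalarTower ℝ ℍ[ℝ] X] [IsScalarTower ℝ ℍ[ℝ]ᵐᵒᵖ X]

theorem resolventSeries_real_smul (T : X →L[ℍ[ℝ]ᵐᵒᵖ] X) (s : ℍ[ℝ]) (r : ℝ) (v : X) :
    resolventSeries T s (r • v) = r • resolventSeries T s v := by
  rw [resolventSeries, resolventSeries, ← tsum_const_smul'']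
  simp only [quaternion_smul_real_smul, map_real_smul]

theorem resolventSqSeries_real_smul (T : X →L[ℍ[ℝ]ᵐᵒᵖ] X) (s : ℍ[ℝ]) (r : ℝ) (v : X) :
    resolventSqSeries T s (r • v) = r • resolventSqSeries T s v := by
  rw [resolventSqSeries, resolventSqSeries, ← tsum_const_smul'']
  refine tsum_congr fun k => ?_
  rw [quaternion_smul_real_smul, map_real_smul, smul_comm]

variable [CompleteSpace X] [NormSMulClass ℍ[ℝ] X] {T : X →L[ℍ[ℝ]ᵐᵒᵖ] X} {c q : ℝ} (hq : 0 < q)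
  (hT : ∀ n, ‖T.restrictScalars ℝ ^ n‖ ≤ c * q ^ n) {s : ℍ[ℝ]} (hs : q < ‖s‖)

include hq hT hs

/-- `Q_s(T) S_L^{-1}(s,T) = s̄ I - T`. The resolvent equation is used at `v` and at `s̄ v`,
together with `s + s̄ = 2 Re(s)` and `s s̄ = |s|²`, which are real and so pass through the series.
-/
theorem Q_resolventSeries (v : X) :
    Q s T (resolventSeries T s v) = star s • v - T v := by
  have h1 : resolventSeries T s (star s • v) =
      (2 * s.re) • resolventSeries T s v - T (resolventSeries T s v) - v := by
    rw [sub_sub, ← resolventSeries_smul hq hT hs, eq_sub_iff_add_eq,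
      ← resolventSeries_add hq hT hs, star_smul_add_smul, resolventSeries_real_smul]
  have h2 : (‖s‖ ^ 2) • resolventSeries T s v =
      T (resolventSeries T s (star s • v)) + star s • v := by
    rw [← resolventSeries_smul hq hT hs, smul_star_smul, resolventSeries_real_smul]
  rw [Q_apply, h2, h1, map_sub, map_sub, map_real_smul]
  abel

theorem Q_resolventSqSeries (v : X) :
    Q s T (resolventSqSeries T s v) =
      resolventSeries T s (star s • v) - T (resolventSeries T s v) := by
  have h1 : resolventSqSeries T s (star s • v) =
      (2 * s.re) • resolventSqSeries T s v - T (resolventSqSeries T s v)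
        - resolventSeries T s v := by
    rw [sub_sub, ← resolventSqSeries_smul hq hT hs, eq_sub_iff_add_eq,
      ← resolventSqSeries_add hq hT hs, star_smul_add_smul, resolventSqSeries_real_smul]
  have h2 : (‖s‖ ^ 2) • resolventSqSeries T s v =
      T (resolventSqSeries T s (star s • v)) + resolventSeries T s (star s • v) := by
    rw [← resolventSqSeries_smul hq hT hs, smul_star_smul, resolventSqSeries_real_smul]
  rw [Q_apply, h2, h1, map_sub, map_sub, map_real_smul]
  abel

variable [SMulCommClass ℍ[ℝ]ᵐᵒᵖ ℍ[ℝ] X] [NormSMulClass ℍ[ℝ]ᵐᵒᵖ X]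

/-- The left resolvent `S_L^{-2}(s,T)` is the sum of its expansion in powers of `T`: both sides
agree after applying the invertible operator `Q_s(T)²`. -/
theorem sLeftResolventPow_two_apply (v : X) :
    sLeftResolventPow 2 s T v = resolventSqSeries T s v := by
  have hu : IsUnit (Q s T) := mem_sResolventSet_of_geometric T hq hT hs
  have h1 : Q s T (Q s T (resolventSqSeries T s v)) =
      star s • star s • v - (2 : ℝ) • T (star s • v) + T (T v) := by
    have hc : Q s T (T (resolventSeries T s v)) = T (Q s T (resolventSeries T s v)) := by
      simp only [Q_apply, map_add, map_sub, map_real_smul]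
    rw [Q_resolventSqSeries hq hT hs, map_sub, hc, Q_resolventSeries hq hT hs,
      Q_resolventSeries hq hT hs, map_sub, two_smul]
    abel
  have h2 : (∑ m ∈ Finset.range (2 + 1),
      (2).choose m • ((-T) ^ m * scalarOp X (star s ^ (2 - m)))) v =
      Q s T (Q s T (resolventSqSeries T s v)) := by
    rw [h1]
    have h3 : ∀ w, scalarOp X (star s ^ 2) w = star s • star s • w := fun w => by
      rw [smul_smul, ← sq]; rfl
    have h4 : ∀ w, scalarOp X (star s) w = star s • w := fun _ => rfl
    have h5 : ∀ w, scalarOp X 1 w = w := fun _ => one_smul _ _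
    simp [Finset.sum_range_succ, h3, h4, h5, sq (-T), two_smul]
    abel
  have h3 : Ring.inverse (Q s T) ^ 2 * (Q s T * Q s T) = 1 := by
    rw [sq, mul_assoc, ← mul_assoc _ (Q s T), Ring.inverse_mul_cancel _ hu, one_mul,
      Ring.inverse_mul_cancel _ hu]
  rw [sLeftResolventPow]
  refine (congrArg (fun w => (Ring.inverse (Q s T) ^ 2) w) h2).trans ?_
  exact congrArg (fun f : X →L[ℍ[ℝ]ᵐᵒᵖ] X => f (resolventSqSeries T s v)) h3

end Series

/-! ### Coefficient extraction on a slice -/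

section Slice

variable {X : Type*} [NormedAddCommGroup X] [NormedSpace ℝ X]
  [Module ℍ[ℝ] X] [Module ℍ[ℝ]ᵐᵒᵖ X] [IsScalarTower ℝ ℍ[ℝ] X]

theorem resolventSqSeries_coeComplex (T : X →L[ℍ[ℝ]ᵐᵒᵖ] X) (n : ℕ) (v : X) {z : ℂ} (hz : z ≠ 0) :
    resolventSqSeries T z ((z : ℍ[ℝ]) ^ (n + 2) • v) =
      ∑' k : ℕ, ((k : ℝ) + 1) • (T ^ k) (complexSMul v (z ^ ((n : ℤ) - k))) := by
  refine tsum_congr fun k => ?_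
  rw [smul_smul, complexSMul_apply]
  congr 3
  rw [← Quaternion.coe_ofComplex, ← map_inv₀, ← map_pow, ← map_pow, ← map_mul]
  congr 1
  rw [zpow_sub₀ hz, zpow_natCast, zpow_natCast, inv_pow]
  field_simp
  ring

variable [CompleteSpace X] [IsScalarTower ℝ ℍ[ℝ]ᵐᵒᵖ X] [NormSMulClass ℍ[ℝ] X]

/-- Averaging `S_L^{-2}(s,T) s^{n+2} v` over a circle in a slice extracts the `n`-th coefficient
of the resolvent series. -/
theorem circleAverage_resolventSqSeries {T : X →L[ℍ[ℝ]ᵐᵒᵖ] X} {c q r : ℝ} (hq : 0 < q)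
    (hT : ∀ n, ‖T.restrictScalars ℝ ^ n‖ ≤ c * q ^ n) (hr : q < r) (n : ℕ) (v : X) :
    Real.circleAverage (fun z : ℂ => resolventSqSeries T z ((z : ℍ[ℝ]) ^ (n + 2) • v)) 0 r =
      ((n : ℝ) + 1) • (T ^ n) v := by
  have hr0 : 0 < r := hq.trans hr
  let φ : ℕ → ℂ →L[ℝ] X := fun k =>
    ((k : ℝ) + 1) • ((T ^ k).restrictScalars ℝ ∘L complexSMul v)
  have hφ : ∀ k w, φ k w = ((k : ℝ) + 1) • (T ^ k) (complexSMul v w) := fun k w => rfl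
  have hne : ∀ θ, circleMap 0 r θ ≠ 0 := fun θ => circleMap_ne_center hr0.ne'
  let f : ℕ → C(ℝ, X) := fun k =>
    ⟨fun θ => φ k (circleMap 0 r θ ^ ((n : ℤ) - k)),
      (φ k).continuous.comp ((continuous_circleMap 0 r).zpow₀ _ fun θ => Or.inl (hne θ))⟩
  have hf : ∀ k θ, ‖f k θ‖ ≤ ((k : ℝ) + 1) * (c * (r ^ n * ‖v‖) * (q / r) ^ k) := fun k θ => by
    change ‖φ k _‖ ≤ _
    rw [hφ, norm_smul, Real.norm_of_nonneg (by positivity)]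
    gcongr
    refine (norm_pow_apply_le hT k _).trans_eq ?_
    rw [complexSMul_apply, norm_smul, norm_coeComplex, norm_zpow, norm_circleMap_zero,
      abs_of_pos hr0, zpow_sub₀ hr0.ne', zpow_natCast, zpow_natCast, div_pow]
    ring
  have hsum := intervalIntegral.hasSum_intervalIntegral_of_summable_norm (f := f) (a := 0)
    (b := 2 * Real.pi) <|
    (summable_succ_mul_geometric (c * (r ^ n * ‖v‖)) hq hr).of_nonneg_of_le
      (fun k => norm_nonneg _) fun k =>
        (ContinuousMap.norm_le _ ((norm_nonneg _).trans (hf k 0))).2 fun θ => hf k θ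
  -- Only the constant power `z ^ 0`, that is `k = n`, has a nonzero mean.
  have hcoef : ∀ k, (2 * Real.pi)⁻¹ • ∫ θ in (0)..(2 * Real.pi), f k θ =
      if k = n then ((n : ℝ) + 1) • (T ^ n) v else 0 := fun k => by
    have h := (φ k).circleAverage_comp_comm (circleIntegrable_zpow hr0 ((n : ℤ) - k))
    rw [circleAverage_zpow hr0] at h
    refine h.trans ?_
    split_ifs with h1 h2 h2
    · subst h2
      rw [hφ, complexSMul_apply, Quaternion.coeComplex_one, one_smul]
    · omega
    · omega
    · exact map_zero _
  have hsum2 := hsum.const_smul (2 * Real.pi)⁻¹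
  simp_rw [hcoef] at hsum2
  rw [← hsum2.unique (hasSum_ite_eq n _), Real.circleAverage]
  congr 2
  ext θ
  rw [resolventSqSeries_coeComplex T n v (hne θ)]
  rfl

end Slice

/-! ### The resolvent estimate and the growth of the powers -/

section Estimate

variable {X : Type*} [NormedAddCommGroup X] [NormedSpace ℝ X] [CompleteSpace X]
  [Module ℍ[ℝ] X] [Module ℍ[ℝ]ᵐᵒᵖ X] [SMulCommClass ℍ[ℝ]ᵐᵒᵖ ℍ[ℝ] X]
  [IsScalarTower ℝ ℍ[ℝ] X] [IsScalarTower ℝ ℍ[ℝ]ᵐᵒᵖ X]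
  [NormSMulClass ℍ[ℝ] X] [NormSMulClass ℍ[ℝ]ᵐᵒᵖ X]

/-- The growth estimate at a radius `r > 1` above a geometric growth rate of the powers of `T`. -/
theorem succ_mul_opNorm_pow_le {T : X →L[ℍ[ℝ]ᵐᵒᵖ] X} {C α : ℝ} (hC : 0 < C) (hα : 0 < α)
    (hα' : α ≤ 1)
    (hres : ∀ s : ℍ[ℝ], s ∈ sResolventSet T → 1 < ‖s‖ →
      opNorm (sLeftResolventPow 2 s T) ≤ C / ‖s - 1‖ ^ (1 + α))
    {c q r : ℝ} (hq : 0 < q) (hT : ∀ n, ‖T.restrictScalars ℝ ^ n‖ ≤ c * q ^ n) (hr : q < r)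
    (hr1 : 1 < r) (n : ℕ) :
    ((n : ℝ) + 1) * ‖T.restrictScalars ℝ ^ n‖ ≤ C * r ^ (n + 2) / (r - 1) := by
  have hr0 : 0 < r := hq.trans hr
  have hrs : 0 < r - 1 := by linarith
  rw [mul_comm, ← le_div_iff₀ (by positivity)]
  refine ContinuousLinearMap.opNorm_le_bound _ (by positivity) fun v => ?_
  rw [div_mul_eq_mul_div, le_div_iff₀ (by positivity), mul_comm]
  have hne : ∀ z : ℂ, ‖z‖ = r → 0 < ‖z - 1‖ := fun z hz => by
    rw [norm_pos_iff, sub_ne_zero]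
    rintro rfl
    rw [norm_one] at hz
    linarith
  have hint : CircleIntegrable (fun z : ℂ => (C * (r + 1) * r ^ (n + 2) * ‖v‖) •
      (‖z - 1‖ ^ 2)⁻¹) 0 r := by
    have hcont : ContinuousOn (fun z : ℂ => ‖z - 1‖ ^ 2) (Metric.sphere 0 r) := by fun_prop
    have hinv : ContinuousOn (fun z : ℂ => (‖z - 1‖ ^ 2)⁻¹) (Metric.sphere 0 r) :=
      hcont.inv₀ fun z hz => (pow_pos (hne z (by simpa using hz)) 2).ne'
    exact ContinuousOn.circleIntegrable hr0.le (by fun_prop)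
  have key := norm_circleAverage_le
    (f := fun z : ℂ => resolventSqSeries T z ((z : ℍ[ℝ]) ^ (n + 2) • v)) hr0.le hint ?_
  · rw [circleAverage_resolventSqSeries hq hT hr, Real.circleAverage_fun_smul,
      circleAverage_inv_norm_sub_one_sq hr1, norm_smul, Real.norm_of_nonneg (by positivity),
      ← restrictScalars_pow] at *
    refine key.trans_eq ?_
    have : r ^ 2 - 1 = (r + 1) * (r - 1) := by ring
    rw [this, smul_eq_mul]
    field_simp
  · intro z hz
    have hzn : ‖(z : ℍ[ℝ])‖ = r := by rw [norm_coeComplex, hz]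
    have hz1 : ‖(z : ℍ[ℝ]) - 1‖ = ‖z - 1‖ := by
      rw [← norm_coeComplex, ← Quaternion.coe_ofComplex, map_sub, map_one]
    have hp := hne z hz
    have hle : ‖z - 1‖ ≤ r + 1 := by simpa [hz] using norm_sub_le z 1
    rw [← sLeftResolventPow_two_apply hq hT (by rw [hzn]; exact hr)]
    refine (norm_apply_le_opNorm _ _).trans ?_
    rw [norm_smul, norm_pow, hzn, smul_eq_mul]
    have h1 := hres z (mem_sResolventSet_of_geometric T hq hT (by rw [hzn]; exact hr))
      (by rw [hzn]; exact hr1)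
    rw [hz1] at h1
    -- Since `1 - α ∈ [0, 1)` and `r + 1 ≥ 1`, the missing factor `|z - 1| ^ (1 - α)` is at
    -- most `r + 1`.
    have h2 : C / ‖z - 1‖ ^ (1 + α) ≤ C * (r + 1) * (‖z - 1‖ ^ 2)⁻¹ := by
      have h3 : ‖z - 1‖ ^ 2 = ‖z - 1‖ ^ (1 + α) * ‖z - 1‖ ^ (1 - α) := by
        rw [← Real.rpow_add hp, ← Real.rpow_natCast]
        congr 1
        push_cast
        ring
      have h4 : ‖z - 1‖ ^ (1 - α) ≤ r + 1 :=
        (Real.rpow_le_rpow hp.le hle (by linarith)).trans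
          (Real.rpow_le_self_of_one_le (by linarith) (by linarith))
      have h5 := Real.rpow_pos_of_pos hp (1 + α)
      rw [← div_eq_mul_inv, div_le_div_iff₀ h5 (by positivity), h3]
      nlinarith [mul_pos hC h5]
    calc _ ≤ C * (r + 1) * (‖z - 1‖ ^ 2)⁻¹ * (r ^ (n + 2) * ‖v‖) := by
          gcongr
          exact h1.trans h2
      _ = _ := by ring

end Estimate

end QuaternionicOperator

theorem theorem3p8 {X : Type*} [NormedAddCommGroup X] [NormedSpace ℝ X] [CompleteSpace X]
    [Module ℍ[ℝ] X] [Module ℍ[ℝ]ᵐᵒᵖ X] [SMulCommClass ℍ[ℝ]ᵐᵒᵖ ℍ[ℝ] X]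
    [IsScalarTower ℝ ℍ[ℝ] X] [IsScalarTower ℝ ℍ[ℝ]ᵐᵒᵖ X]
    [NormSMulClass ℍ[ℝ] X] [NormSMulClass ℍ[ℝ]ᵐᵒᵖ X]
    (T : X →L[ℍ[ℝ]ᵐᵒᵖ] X)
    (hspec : QuaternionicOperator.sSpectrum T ∩ Metric.sphere (0 : ℍ[ℝ]) 1 ⊆ {1})
    (C α : ℝ) (hC : 0 < C) (hα : 0 < α) (hα' : α ≤ 1)
    (hres : ∀ s : ℍ[ℝ], s ∈ QuaternionicOperator.sResolventSet T → 1 < ‖s‖ →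
      QuaternionicOperator.opNorm (QuaternionicOperator.sLeftResolventPow 2 s T)
        ≤ C / ‖s - 1‖ ^ (1 + α)) :
    QuaternionicOperator.IsPowerBounded T := by
  refine ⟨C * (Real.exp 1 * 2), ?_⟩
  rintro _ ⟨n, -, rfl⟩
  have hn : (0 : ℝ) < n + 1 := by positivity
  -- The radius `1 + 1 / (n + 1)` turns the factor `1 / (r - 1)` into `n + 1`.
  set x : ℝ := ((n : ℝ) + 1)⁻¹ with hx
  have hx0 : 0 < x := inv_pos.2 hn
  have hx1 : x ≤ 1 := inv_le_one_of_one_le₀ (by linarith [n.cast_nonneg (α := ℝ)])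
  have h := QuaternionicOperator.forall_succ_mul_norm_pow_le
    (fun c q r hq hT hr hr1 =>
      QuaternionicOperator.succ_mul_opNorm_pow_le hC hα hα' hres (c := c) hq hT hr hr1)
    (show 1 < 1 + x by linarith) n
  have hexp : (1 + x) ^ (n + 1) ≤ Real.exp 1 := by
    calc (1 + x) ^ (n + 1) ≤ Real.exp x ^ (n + 1) := by
          gcongr
          linarith [Real.add_one_le_exp x]
      _ = Real.exp 1 := by
          rw [← Real.exp_nat_mul]
          congr 1
          push_cast
          exact mul_inv_cancel₀ hn.ne'
  have hpow : (1 + x) ^ (n + 2) ≤ Real.exp 1 * 2 := by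
    rw [pow_succ]
    exact mul_le_mul hexp (by linarith) (by positivity) (Real.exp_pos 1).le
  rw [add_sub_cancel_left, hx, div_inv_eq_mul, mul_comm _ ((n : ℝ) + 1),
    mul_le_mul_iff_right₀ hn] at h
  change ‖(T ^ n).restrictScalars ℝ‖ ≤ _
  rw [QuaternionicOperator.restrictScalars_pow]
  exact h.trans (mul_le_mul_of_nonneg_left hpow hC.le)
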